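/- Let $\Sigma\subset\mathbb{R}^{n\times n}$, $n\ge 1$, be a nonempty finite set of matrices, with joint spectral radius \[ \rho(\Sigma)=\limsup_{k\to\infty}\ \max\bigl\{\|A_1\cdots A_k\|^{1/k} : A_1,\dots,A_k\in\Sigma\bigr\} \] (for any fixed matrix norm, e.g. the spectral norm; the value does not depend on the choice). For an integer $k\ge 0$ put \[ D(n,k)=\sum_{m=0}^{\lfloor k/2\rfloor}\binom{n+k-1-2m}{k-2m}. \] A function $f:\mathbb{R}^n\to\mathbb{R}$ is continuous piecewise linear (CPWL) if it is continuous and $\mathbb{R}^n$ is the union of finitely many polyhedra (finite intersections of closed half-spaces) on each of which $f$ coincides with a linear functional. For $N\in\mathbb{N}$ let $\rho_{\mathcal P,N}(\Sigma)$ be the infimum of $\max_{A\in\Sigma}\|A\|$ over all norms $\|\cdot\|$ on $\mathbb{R}^n$ that are CPWL functions and whose closed unit ball has at most $N$ vertices (extreme points), where $\|A\|$ is the induced matrix norm. Let $\tau>1$ be real and let $k$ be a nonnegative integer such that \[ \bigl(\tau-\sqrt{\tau^2-1}\bigr)^k+\bigl(\tau+\sqrt{\tau^2-1}\bigr)^k\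 \ge\ 6\,D(n,k)^{1/2}. \] Then there is at least one CPWL norm on $\mathbb{R}^n$ whose unit ball has at most $8D(n,k)$ vertices, and \[ \frac1\tau\,\rho_{\mathcal P,\,8D(n,k)}(\Sigma)\ \le\ \rho(\Sigma)\ \le\ \rho_{\mathcal P,\,8D(n,k)}(\Sigma). \] -/

import Mathlib

noncomputable section

namespace CPWLJSR

/-- The set `S ^ k` of all products `A₁ * ⋯ * A_k` of length `k` of matrices in `S`. -/
def products {n : ℕ} (S : Set (Matrix (Fin n) (Fin n) ℝ)) (k : ℕ) :
    Set (Matrix (Fin n) (Fin n) ℝ) :=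
  {B | ∃ A : Fin k → Matrix (Fin n) (Fin n) ℝ, (∀ i, A i ∈ S) ∧ B = (List.ofFn A).prod}

/-- The joint spectral radius: the limsup, as `k → ∞`, of the supremum of `‖A‖ ^ (1 / k)` over the
products `A` of length `k`. The matrix norm used is the operator norm of the Euclidean norm; all
matrix norms give the same value. -/
def jointSpectralRadius {n : ℕ} (S : Set (Matrix (Fin n) (Fin n) ℝ)) : ℝ :=
  Filter.limsup
    (fun k : ℕ => sSup ((fun A : Matrix (Fin n) (Fin n) ℝ =>
      ‖Matrix.toEuclideanCLM (n := Fin n) (𝕜 := ℝ) A‖ ^ (1 / (k : ℝ))) '' products S k))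
    Filter.atTop

/-- A polyhedron in `ℝⁿ`: an intersection of finitely many closed half-spaces. -/
def IsPolyhedron {n : ℕ} (P : Set (Fin n → ℝ)) : Prop :=
  ∃ (m : ℕ) (a : Fin m → Fin n → ℝ) (b : Fin m → ℝ), P = {x | ∀ i, a i ⬝ᵥ x ≤ b i}

/-- A continuous piecewise linear function: `ℝⁿ` is a finite union of polyhedra on each of which
the function agrees with a linear functional. -/
def IsCPWL {n : ℕ} (f : (Fin n → ℝ) → ℝ) : Prop :=
  Continuous f ∧
    ∃ F : Set (Set (Fin n → ℝ)), F.Finite ∧ (∀ P ∈ F, IsPolyhedron P) ∧ ⋃₀ F = Set.univ ∧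
      ∀ P ∈ F, ∃ l : (Fin n → ℝ) →ₗ[ℝ] ℝ, ∀ x ∈ P, f x = l x

/-- `V` is a norm on `ℝⁿ`: a seminorm that vanishes only at `0`. -/
def IsNorm {n : ℕ} (V : Seminorm ℝ (Fin n → ℝ)) : Prop :=
  ∀ x, V x = 0 → x = 0

/-- The CPWL norms on `ℝⁿ` whose unit ball has at most `N` vertices. -/
def cpwlNorms (n N : ℕ) : Set (Seminorm ℝ (Fin n → ℝ)) :=
  {V | IsNorm V ∧ IsCPWL V ∧ (Set.extremePoints ℝ (V.closedBall 0 1)).encard ≤ (N : ℕ∞)}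

/-- The matrix norm induced by a norm `V` on `ℝⁿ`: the least `c ≥ 0` with
`V (A x) ≤ c * V x` for all `x`. -/
def inducedNorm {n : ℕ} (V : Seminorm ℝ (Fin n → ℝ)) (A : Matrix (Fin n) (Fin n) ℝ) : ℝ :=
  sInf {c : ℝ | 0 ≤ c ∧ ∀ x, V (A.mulVec x) ≤ c * V x}

/-- The CPWL approximation of the joint spectral radius: the infimum of `max_{A ∈ S} ‖A‖` over the
matrix norms induced by CPWL norms whose unit ball has at most `N` vertices. -/
def cpwlRadius {n : ℕ} (N : ℕ) (S : Set (Matrix (Fin n) (Fin n) ℝ)) : ℝ :=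
  sInf ((fun V : Seminorm ℝ (Fin n → ℝ) => sSup (inducedNorm V '' S)) '' cpwlNorms n N)

/-- `D(n, k) = ∑_{m = 0}^{⌊k / 2⌋} binom (n + k - 1 - 2 m) (k - 2 m)`, for `n ≥ 1`. -/
def barvinokD (n k : ℕ) : ℕ :=
  ∑ m ∈ Finset.range (k / 2 + 1), Nat.choose (n + k - 1 - 2 * m) (k - 2 * m)

end CPWLJSR

end

/-! For `r` above the joint spectral radius, the body `orbitBody S r` is compact, convex, symmetric
and a neighbourhood of `0`, and every `A ∈ S` maps it into its dilation by `r`. If a polytope `P`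
satisfies `P ⊆ B ⊆ τ P` for this body `B`, then `A P ⊆ r B ⊆ r τ P`, so in the norm with unit ball
`P` every `A` has norm at most `τ r`; let `r` decrease to the radius. The other inequality holds
because any norm bounds the growth of products.

The polytope is Barvinok's (`exists_family_controlling_dotProduct`). Among families of `2 d` points
of a compact set in dimension `d`, one maximizing `det ∑ x xᵀ` controls every linear functional up
to `√(2 d)`. Applied to the image of `B` under monomials of degree at most `k` and of the parity of
`k`, where `T_k (a ⬝ᵥ x)` becomes linear, this improves to the factor `τ` on `B`: `T_k` is bounded
by `1` on `[-1, 1]` but at least `3 √D` beyond `τ`. By separation, the hull of the chosen points and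
their negatives is `P`. -/

/-! ### Determinant-maximal families -/

open Matrix in
/-- Replacing one term `x i` of a Gram-type sum by `y` multiplies the determinant by an explicit
factor. -/
theorem det_sum_vecMulVec_update {ι : Type*} [Fintype ι] [DecidableEq ι] {d : ℕ}
    (x : ι → Fin d → ℝ) (hx : IsUnit (∑ i, vecMulVec (x i) (x i)).det) (i : ι) (y : Fin d → ℝ) :
    (∑ j, vecMulVec (Function.update x i y j) (Function.update x i y j)).det =
      (∑ j, vecMulVec (x j) (x j)).det *
        ((1 + y ⬝ᵥ (∑ j, vecMulVec (x j) (x j))⁻¹ *ᵥ y) *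
            (1 - x i ⬝ᵥ (∑ j, vecMulVec (x j) (x j))⁻¹ *ᵥ x i) +
          (y ⬝ᵥ (∑ j, vecMulVec (x j) (x j))⁻¹ *ᵥ x i) *
            (x i ⬝ᵥ (∑ j, vecMulVec (x j) (x j))⁻¹ *ᵥ y)) := by
  set M := ∑ j, vecMulVec (x j) (x j) with hM
  -- The update adds `y yᵀ - x_i x_iᵀ = U V`, of rank at most two, so the determinant lemma leaves a
  -- `2 × 2` determinant.
  let U : Matrix (Fin d) (Fin 2) ℝ := (of ![y, x i])ᵀ
  let V : Matrix (Fin 2) (Fin d) ℝ := of ![y, -x i]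
  have hUV : ∑ j, vecMulVec (Function.update x i y j) (Function.update x i y j) = M + U * V := by
    have h1 : U * V = vecMulVec y y - vecMulVec (x i) (x i) := by
      ext a b
      simp [U, V, mul_apply, Fin.sum_univ_two, vecMulVec_apply, sub_eq_add_neg]
    rw [h1, hM, ← Finset.add_sum_erase _ _ (Finset.mem_univ i),
      ← Finset.add_sum_erase _ (fun j => vecMulVec (x j) (x j)) (Finset.mem_univ i)]
    rw [Finset.sum_congr rfl (g := fun j => vecMulVec (x j) (x j))]
    · simp only [Function.update_self]
      abel
    · intro j hj
      rw [Function.update_of_ne (Finset.ne_of_mem_erase hj)]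
  have hent : ∀ a b, (V * M⁻¹ * U) a b = V a ⬝ᵥ M⁻¹ *ᵥ (Uᵀ b) := by
    intro a b
    rw [Matrix.mul_assoc]
    simp [mul_apply, dotProduct, mulVec]
  have hU0 : Uᵀ 0 = y := rfl
  have hU1 : Uᵀ 1 = x i := rfl
  have hV0 : V 0 = y := rfl
  have hV1 : V 1 = -x i := rfl
  rw [hUV, det_add_mul _ _ hx, det_fin_two]
  simp only [Matrix.add_apply, hent, Matrix.one_apply, hU0, hU1, hV0, hV1, neg_dotProduct]
  simp only [if_true, zero_ne_one, one_ne_zero, if_false]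
  ring

open Matrix in
/-- If `∑ i, x i (x i)ᵀ` has maximal determinant among the families with values in `K`, then the
value of a linear functional on `K` is controlled by its values on the family. -/
theorem sq_dotProduct_le_of_det_maximal {ι : Type*} [Fintype ι] {d : ℕ}
    {K : Set (Fin d → ℝ)} {x : ι → Fin d → ℝ}
    (hpos : 0 < (∑ i, vecMulVec (x i) (x i)).det) (hxK : ∀ i, x i ∈ K)
    (hmax : ∀ z : ι → Fin d → ℝ, (∀ i, z i ∈ K) →
      (∑ i, vecMulVec (z i) (z i)).det ≤ (∑ i, vecMulVec (x i) (x i)).det)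
    (a : Fin d → ℝ) {y : Fin d → ℝ} (hy : y ∈ K) (hcard : d ≤ Fintype.card ι) :
    (a ⬝ᵥ y) ^ 2 * (Fintype.card ι - d + 1) ≤ d * ∑ i, (a ⬝ᵥ x i) ^ 2 := by
  classical
  set M := ∑ j, vecMulVec (x j) (x j) with hM
  have hu : IsUnit M.det := hpos.ne'.isUnit
  have hMmul : ∀ v, M *ᵥ v = ∑ i, (x i ⬝ᵥ v) • x i := by
    intro v
    rw [hM, Matrix.sum_mulVec]
    simp [vecMulVec_mulVec]
  have hsymm : (M⁻¹)ᵀ = M⁻¹ := by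
    rw [transpose_nonsing_inv, hM, transpose_sum]
    simp [transpose_vecMulVec]
  have hcomm : ∀ u v, u ⬝ᵥ M⁻¹ *ᵥ v = v ⬝ᵥ M⁻¹ *ᵥ u := by
    intro u v
    rw [dotProduct_mulVec, ← mulVec_transpose, hsymm, dotProduct_comm]
  have hid : ∀ v, M *ᵥ (M⁻¹ *ᵥ v) = v := by
    intro v
    rw [mulVec_mulVec, mul_nonsing_inv _ hu, one_mulVec]
  have hexp : ∀ a v, a ⬝ᵥ v = ∑ i, (x i ⬝ᵥ M⁻¹ *ᵥ v) * (a ⬝ᵥ x i) := by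
    intro a v
    conv_lhs => rw [← hid v, hMmul, dotProduct_sum]
    simp
  set δ := y ⬝ᵥ M⁻¹ *ᵥ y with hδ
  have hsq : ∑ i, (x i ⬝ᵥ M⁻¹ *ᵥ y) ^ 2 = δ := by
    have := hexp (M⁻¹ *ᵥ y) y
    rw [dotProduct_comm] at this
    rw [hδ, this]
    refine Finset.sum_congr rfl fun i _ => ?_
    rw [dotProduct_comm (M⁻¹ *ᵥ y), sq]
  have htr : ∑ i, x i ⬝ᵥ M⁻¹ *ᵥ x i = d := by
    have h1 : (M⁻¹ * M).trace = d := by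
      rw [nonsing_inv_mul _ hu]
      simp
    rw [← h1]
    nth_rewrite 3 [hM]
    rw [Matrix.mul_sum, trace_sum]
    refine Finset.sum_congr rfl fun i _ => ?_
    rw [mul_vecMulVec, trace_vecMulVec, dotProduct_comm]
  have hstep : ∀ i, (1 + δ) * (1 - x i ⬝ᵥ M⁻¹ *ᵥ x i) + (x i ⬝ᵥ M⁻¹ *ᵥ y) ^ 2 ≤ 1 := by
    intro i
    have h1 := hmax (Function.update x i y) (by
      intro j
      by_cases h : j = i
      · subst h; simpa using hy
      · simpa [Function.update_of_ne h] using hxK j)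
    rw [det_sum_vecMulVec_update x hu i y, ← hM, hcomm y (x i), ← sq] at h1
    exact (mul_le_iff_le_one_right hpos).1 h1
  -- With `N` points, summing the exchange inequalities gives `(1 + δ)(N - d) + δ ≤ N`, that is, `δ
  -- (N - d + 1) ≤ d`.
  have hsum := Finset.sum_le_sum fun i (_ : i ∈ Finset.univ) => hstep i
  rw [Finset.sum_add_distrib, ← Finset.mul_sum, Finset.sum_sub_distrib, htr, hsq] at hsum
  simp only [Finset.sum_const, Finset.card_univ, nsmul_eq_mul, mul_one] at hsum
  have hcs : (a ⬝ᵥ y) ^ 2 ≤ δ * ∑ i, (a ⬝ᵥ x i) ^ 2 := by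
    rw [hexp a y, ← hsq]
    exact Finset.sum_mul_sq_le_sq_mul_sq _ _ _
  have hc : (d : ℝ) ≤ Fintype.card ι := by exact_mod_cast hcard
  calc (a ⬝ᵥ y) ^ 2 * (Fintype.card ι - d + 1)
      ≤ (δ * ∑ i, (a ⬝ᵥ x i) ^ 2) * (Fintype.card ι - d + 1) := by
        gcongr
    _ = (δ * (Fintype.card ι - d + 1)) * ∑ i, (a ⬝ᵥ x i) ^ 2 := by ring
    _ ≤ d * ∑ i, (a ⬝ᵥ x i) ^ 2 := by
        gcongr
        linarith

open Matrix in
/-- A compact set containing the standard basis contains `2 d` points which control every linear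
functional on it up to the factor `√(2 d)`. -/
theorem exists_controlling_family {d : ℕ} {K : Set (Fin d → ℝ)} (hK : IsCompact K)
    (hbasis : ∀ i, Pi.single i 1 ∈ K) :
    ∃ x : Fin d ⊕ Fin d → Fin d → ℝ, (∀ i, x i ∈ K) ∧
      ∀ a : Fin d → ℝ, (∀ i, |a ⬝ᵥ x i| ≤ 1) → ∀ y ∈ K, (a ⬝ᵥ y) ^ 2 ≤ 2 * d := by
  have hcont : Continuous fun x : Fin d ⊕ Fin d → Fin d → ℝ =>
      (∑ i, vecMulVec (x i) (x i)).det := by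
    refine Continuous.matrix_det (continuous_finsetSum _ fun i _ => ?_)
    exact Continuous.matrix_vecMulVec (continuous_apply i) (continuous_apply i)
  have hcomp : IsCompact (Set.univ.pi fun _ : Fin d ⊕ Fin d => K) :=
    isCompact_univ_pi fun _ => hK
  -- The doubled basis has determinant `2 ^ d`, so the maximum is positive.
  let b : Fin d ⊕ Fin d → Fin d → ℝ :=
    Sum.elim (fun i => Pi.single i 1) (fun i => Pi.single i 1)
  have hb : b ∈ Set.univ.pi fun _ : Fin d ⊕ Fin d => K := by
    rintro (i | i) _ <;> exact hbasis i
  obtain ⟨x, hxK, hx⟩ := hcomp.exists_isMaxOn ⟨b, hb⟩ hcont.continuousOn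
  have hone : ∑ i : Fin d, vecMulVec (Pi.single i (1 : ℝ)) (Pi.single i 1) =
      (1 : Matrix (Fin d) (Fin d) ℝ) := by
    ext i j
    simp [Matrix.sum_apply, vecMulVec_apply, Pi.single_apply, Matrix.one_apply]
  have hbdet : 0 < (∑ i, vecMulVec (b i) (b i)).det := by
    have : ∑ i, vecMulVec (b i) (b i) = (2 : ℝ) • (1 : Matrix (Fin d) (Fin d) ℝ) := by
      rw [Fintype.sum_sum_type]
      simp only [b, Sum.elim_inl, Sum.elim_inr, hone, two_smul]
    rw [this, det_smul]
    simp
  refine ⟨x, fun i => hxK i trivial, fun a ha y hy => ?_⟩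
  have h := sq_dotProduct_le_of_det_maximal (hbdet.trans_le (hx hb)) (fun i => hxK i trivial)
    (fun z hz => hx fun i _ => hz i) a hy (by simp)
  have h2 : ∑ i, (a ⬝ᵥ x i) ^ 2 ≤ 2 * d := by
    calc ∑ i, (a ⬝ᵥ x i) ^ 2 ≤ ∑ _i : Fin d ⊕ Fin d, (1 : ℝ) :=
          Finset.sum_le_sum fun i _ => (sq_le_one_iff_abs_le_one _).2 (ha i)
      _ = 2 * d := by simp; ring
  simp only [Fintype.card_sum, Fintype.card_fin, Nat.cast_add, add_sub_cancel_right] at h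
  have hd : (0 : ℝ) ≤ d := by positivity
  have h3 : (d : ℝ) * ∑ i, (a ⬝ᵥ x i) ^ 2 ≤ d * (2 * d) := by gcongr
  by_contra! hcon
  have : 2 * (d : ℝ) * (d + 1) < (a ⬝ᵥ y) ^ 2 * (d + 1) := by gcongr
  nlinarith

open Matrix in
/-- A compact set, mapped continuously to a space of dimension `D`, contains a family of at most
`2 D` points which controls every linear functional of the image up to the factor `√(2 D)`. -/
theorem exists_controlling_family_comp {X κ : Type*} [TopologicalSpace X] [Fintype κ]
    {B : Set X} (hB : IsCompact B) {φ : X → κ → ℝ} (hφ : ContinuousOn φ B) :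
    ∃ d ≤ Fintype.card κ, ∃ x : Fin d ⊕ Fin d → X, (∀ i, x i ∈ B) ∧
      ∀ c : κ → ℝ, (∀ i, |c ⬝ᵥ φ (x i)| ≤ 1) → ∀ y ∈ B,
        (c ⬝ᵥ φ y) ^ 2 ≤ 2 * Fintype.card κ := by
  -- The image may span a proper subspace. Coordinates `G` in a basis `f` taken from the image
  -- itself make the standard basis part of the compact set.
  obtain ⟨f, hf, hspan, hli⟩ := Submodule.exists_fun_fin_finrank_span_eq ℝ (φ '' B)
  have hdle : Module.finrank ℝ (Submodule.span ℝ (φ '' B)) ≤ Fintype.card κ := by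
    simpa using Submodule.finrank_le (Submodule.span ℝ (φ '' B))
  generalize Module.finrank ℝ (Submodule.span ℝ (φ '' B)) = d at f hdle
  obtain ⟨G, hG⟩ := (Fintype.linearCombination ℝ f).exists_leftInverse_of_injective
    (LinearMap.ker_eq_bot.2 (linearIndependent_iff_injective_fintypeLinearCombination.1 hli))
  have hGF : ∀ v, G (Fintype.linearCombination ℝ f v) = v := fun v => LinearMap.congr_fun hG v
  have hFG : ∀ y ∈ B, Fintype.linearCombination ℝ f (G (φ y)) = φ y := by
    intro y hy
    have : φ y ∈ Submodule.span ℝ (Set.range f) :=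
      hspan ▸ Submodule.subset_span (Set.mem_image_of_mem φ hy)
    rw [← Fintype.range_linearCombination] at this
    obtain ⟨v, hv⟩ := this
    rw [← hv, hGF]
  have hK : IsCompact (G '' (φ '' B)) :=
    (hB.image_of_continuousOn hφ).image G.continuous_of_finiteDimensional
  obtain ⟨x, hx, hctrl⟩ := exists_controlling_family hK fun i => by
    refine ⟨f i, hf i, ?_⟩
    rw [← hGF (Pi.single i 1)]
    simp [Fintype.linearCombination_apply_single]
  choose z hz using hx
  choose w hw using fun i => (hz i).1
  have hdot : ∀ c : κ → ℝ, ∀ y ∈ B, c ⬝ᵥ φ y = (fun i => c ⬝ᵥ f i) ⬝ᵥ G (φ y) := by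
    intro c y hy
    conv_lhs => rw [← hFG y hy, Fintype.linearCombination_apply, dotProduct_sum]
    simp only [dotProduct_smul, smul_eq_mul, mul_comm]
    rfl
  refine ⟨d, hdle, w, fun i => (hw i).1, fun c hc y hy => ?_⟩
  rw [hdot c y hy]
  refine (hctrl _ (fun i => ?_) _ ⟨_, ⟨y, hy, rfl⟩, rfl⟩).trans ?_
  · have := hc i
    rwa [hdot c _ (hw i).1, (hw i).2, (hz i).2] at this
  · have : (d : ℝ) ≤ Fintype.card κ := by exact_mod_cast hdle
    linarith

/-! ### Chebyshev polynomials, monomials and Barvinok's theorem -/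

open Polynomial in
/-- The Chebyshev polynomial `T k` is a linear combination of the monomials `X ^ (k - 2 m)`. -/
theorem chebyshev_T_mem_span (k : ℕ) :
    Chebyshev.T ℝ k ∈ Submodule.span ℝ {p : ℝ[X] | ∃ m, 2 * m ≤ k ∧ p = X ^ (k - 2 * m)} := by
  induction k using Nat.twoStepInduction with
  | zero => exact Submodule.subset_span ⟨0, by simp⟩
  | one => exact Submodule.subset_span ⟨0, by simp⟩
  | more k ih0 ih1 =>
    have h : Chebyshev.T ℝ ((k + 2 : ℕ) : ℤ) =
        (2 : ℝ) • (X * Chebyshev.T ℝ ((k + 1 : ℕ) : ℤ)) - Chebyshev.T ℝ (k : ℤ) := by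
      push_cast
      rw [Chebyshev.T_add_two, smul_eq_C_mul, map_ofNat]
      ring
    rw [h]
    refine Submodule.sub_mem _ (Submodule.smul_mem _ _ ?_) ?_
    · have := Submodule.mem_map_of_mem (f := LinearMap.mulLeft ℝ (X : ℝ[X])) ih1
      rw [Submodule.map_span] at this
      refine Submodule.span_mono ?_ this
      rintro _ ⟨_, ⟨m, hm, rfl⟩, rfl⟩
      refine ⟨m, by lia, ?_⟩
      rw [LinearMap.mulLeft_apply, ← pow_succ']
      congr 1
      lia
    · refine Submodule.span_mono ?_ ih0
      rintro _ ⟨m, hm, rfl⟩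
      exact ⟨m + 1, by lia, by congr 1; lia⟩

/-- The index set of the monomials in `n` variables whose degree is at most `k` and has the parity
of `k`. -/
abbrev ParityMonomial (n k : ℕ) : Type := Σ m : Fin (k / 2 + 1), Sym (Fin n) (k - 2 * m)

/-- The values at `x` of the monomials whose degree is at most `k` and has the parity of `k`. -/
def parityVeronese (n k : ℕ) (x : Fin n → ℝ) (s : ParityMonomial n k) : ℝ :=
  ((s.2 : Multiset (Fin n)).map x).prod

theorem card_parityMonomial {n : ℕ} (hn : 0 < n) (k : ℕ) :
    Fintype.card (ParityMonomial n k) = CPWLJSR.barvinokD n k := by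
  rw [Fintype.card_sigma, CPWLJSR.barvinokD, Finset.sum_range]
  refine Finset.sum_congr rfl fun m _ => ?_
  rw [Sym.card_sym_eq_choose, Fintype.card_fin]
  congr 1
  have := m.2
  lia

theorem barvinokD_pos {n : ℕ} (hn : 0 < n) (k : ℕ) : 0 < CPWLJSR.barvinokD n k :=
  Finset.sum_pos (fun m _ => Nat.choose_pos (by lia)) ⟨0, by simp⟩

theorem continuous_parityVeronese (n k : ℕ) : Continuous (parityVeronese n k) := by
  refine continuous_pi fun s => ?_
  simp only [parityVeronese]
  exact continuous_multiset_prod _ fun i _ => continuous_apply i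

open Polynomial in
/-- If `p` is a linear combination of the monomials `X ^ (k - 2 m)`, then `p (a ⬝ᵥ x)` is a linear
functional of `parityVeronese n k x`. -/
theorem exists_eval_dotProduct_eq {n k : ℕ} (a : Fin n → ℝ) {p : ℝ[X]}
    (hp : p ∈ Submodule.span ℝ {p : ℝ[X] | ∃ m, 2 * m ≤ k ∧ p = X ^ (k - 2 * m)}) :
    ∃ c : ParityMonomial n k → ℝ, ∀ x, p.eval (a ⬝ᵥ x) = c ⬝ᵥ parityVeronese n k x := by
  induction hp using Submodule.span_induction with
  | zero => exact ⟨0, by simp⟩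
  | add p q _ _ hp hq =>
    obtain ⟨c, hc⟩ := hp
    obtain ⟨e, he⟩ := hq
    exact ⟨c + e, fun x => by rw [eval_add, hc, he, add_dotProduct]⟩
  | smul r p _ hp =>
    obtain ⟨c, hc⟩ := hp
    exact ⟨r • c, fun x => by rw [eval_smul, hc, smul_dotProduct]⟩
  | mem p hp =>
    obtain ⟨m, hm, rfl⟩ := hp
    let m' : Fin (k / 2 + 1) := ⟨m, by lia⟩
    -- Multinomial coefficients of `(a ⬝ᵥ x) ^ (k - 2 m)`, and zero in the other degrees.
    refine ⟨fun s => if s.1 = m' then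
      (s.2 : Multiset (Fin n)).countPerms * ((s.2 : Multiset (Fin n)).map a).prod else 0,
      fun x => ?_⟩
    rw [eval_pow, eval_X, dotProduct, dotProduct, Fintype.sum_sigma, Finset.sum_pow,
      Finset.sum_eq_single m']
    · simp only [if_true, parityVeronese, Finset.sym_univ]
      refine Finset.sum_congr rfl fun s _ => ?_
      rw [Multiset.prod_map_mul, mul_assoc]
      rfl
    · intro j _ hj
      simp [hj]
    · simp

/-- Put `τ = cosh u`: then `T_k τ = cosh (k u)` and `exp (± u) = τ ± √(τ² - 1)`. This turns the
hypothesis on `k` into `T_k τ ≥ 3 √D`. -/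
theorem two_mul_chebyshev_T_eval {τ : ℝ} (hτ : 1 ≤ τ) (k : ℕ) :
    2 * (Polynomial.Chebyshev.T ℝ k).eval τ =
      (τ - √(τ ^ 2 - 1)) ^ k + (τ + √(τ ^ 2 - 1)) ^ k := by
  conv_lhs => rw [← Real.cosh_arcosh hτ, Polynomial.Chebyshev.T_real_cosh]
  rw [← Real.add_sqrt_self_sq_sub_one_inv hτ, ← Real.exp_arcosh hτ, ← Real.exp_neg,
    ← Real.exp_nat_mul, ← Real.exp_nat_mul, Real.cosh_eq]
  push_cast
  ring_nf

theorem chebyshev_T_eval_le {s t : ℝ} (hs : 1 ≤ s) (hst : s ≤ t) (k : ℕ) :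
    (Polynomial.Chebyshev.T ℝ k).eval s ≤ (Polynomial.Chebyshev.T ℝ k).eval t := by
  have ht := hs.trans hst
  rw [← Real.cosh_arcosh hs, ← Real.cosh_arcosh ht, Polynomial.Chebyshev.T_real_cosh,
    Polynomial.Chebyshev.T_real_cosh, Real.cosh_le_cosh, abs_mul, abs_mul,
    abs_of_nonneg (Real.arcosh_nonneg hs), abs_of_nonneg (Real.arcosh_nonneg ht)]
  have := (Real.arcosh_le_arcosh (by linarith) (by linarith)).2 hst
  gcongr

theorem chebyshev_T_eval_abs_sq (k : ℕ) (t : ℝ) :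
    (Polynomial.Chebyshev.T ℝ k).eval |t| ^ 2 = (Polynomial.Chebyshev.T ℝ k).eval t ^ 2 := by
  rcases abs_choice t with h | h <;> rw [h]
  rw [Polynomial.Chebyshev.T_eval_neg, mul_pow]
  rcases Int.even_or_odd (k : ℤ) with hk | hk
  · simp [Int.negOnePow_even _ hk]
  · simp [Int.negOnePow_odd _ hk]

/-- **Barvinok's theorem**: a compact set contains few points which control every linear functional
on it up to the factor `τ`. -/
theorem exists_family_controlling_dotProduct {n : ℕ} (hn : 0 < n) {B : Set (Fin n → ℝ)}
    (hB : IsCompact B) {τ : ℝ} (hτ : 1 < τ) {k : ℕ}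
    (hk : 6 * √(CPWLJSR.barvinokD n k : ℝ) ≤
      (τ - √(τ ^ 2 - 1)) ^ k + (τ + √(τ ^ 2 - 1)) ^ k) :
    ∃ d ≤ CPWLJSR.barvinokD n k, ∃ x : Fin d ⊕ Fin d → Fin n → ℝ, (∀ i, x i ∈ B) ∧
      ∀ a : Fin n → ℝ, (∀ i, |a ⬝ᵥ x i| ≤ 1) → ∀ y ∈ B, |a ⬝ᵥ y| ≤ τ := by
  obtain ⟨d, hd, x, hx, hctrl⟩ :=
    exists_controlling_family_comp hB (continuous_parityVeronese n k).continuousOn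
  rw [card_parityMonomial hn] at hd hctrl
  refine ⟨d, hd, x, hx, fun a ha y hy => ?_⟩
  obtain ⟨c, hc⟩ := exists_eval_dotProduct_eq a (chebyshev_T_mem_span k)
  have h := hctrl c (fun i => by
    rw [← hc]; exact Polynomial.Chebyshev.abs_eval_T_real_le_one _ (ha i)) y hy
  rw [← hc, ← chebyshev_T_eval_abs_sq] at h
  rw [← two_mul_chebyshev_T_eval hτ.le] at hk
  -- If `|a ⬝ᵥ y| > τ`, monotonicity of `T_k` on `[1, ∞)` makes the square at least `9 D`, against
  -- the bound `2 D`.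
  by_contra! hcon
  have h1 : 3 * √(CPWLJSR.barvinokD n k : ℝ) ≤
      (Polynomial.Chebyshev.T ℝ k).eval |a ⬝ᵥ y| := by
    linarith [chebyshev_T_eval_le hτ.le hcon.le k]
  have hD : (0 : ℝ) < CPWLJSR.barvinokD n k := by exact_mod_cast barvinokD_pos hn k
  have h2 := pow_le_pow_left₀ (by positivity) h1 2
  rw [mul_pow, Real.sq_sqrt hD.le] at h2
  linarith

/-! ### Polytopes and piecewise linear norms -/

/-- The maximum of finitely many linear functionals is continuous piecewise linear. -/
theorem isCPWL_of_finite_dotProduct {n : ℕ} {f : (Fin n → ℝ) → ℝ} {E : Set (Fin n → ℝ)}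
    (hE : E.Finite) (hle : ∀ a ∈ E, ∀ x, a ⬝ᵥ x ≤ f x) (hex : ∀ x, ∃ a ∈ E, a ⬝ᵥ x = f x) :
    CPWLJSR.IsCPWL f := by
  lift E to Finset (Fin n → ℝ) using hE
  have hne : E.Nonempty := let ⟨a, ha, _⟩ := hex 0; ⟨a, ha⟩
  -- One polyhedron for each `a ∈ E`: the region where `a` attains the maximum.
  refine ⟨?_, (fun a => {x | ∀ b ∈ E, (b - a) ⬝ᵥ x ≤ 0}) '' (E : Set (Fin n → ℝ)),
    E.finite_toSet.image _, ?_, ?_, ?_⟩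
  · have hf : f = fun x => E.sup' hne fun a => a ⬝ᵥ x := by
      ext x
      refine le_antisymm ?_ (Finset.sup'_le _ _ fun a ha => hle a ha x)
      obtain ⟨a, ha, hax⟩ := hex x
      rw [← hax]
      exact Finset.le_sup' (fun a => a ⬝ᵥ x) ha
    rw [hf]
    exact Continuous.finset_sup'_apply hne fun a _ => continuous_const.dotProduct continuous_id
  · rintro _ ⟨a, _, rfl⟩
    refine ⟨E.card, fun i => (E.equivFin.symm i : Fin n → ℝ) - a, 0, ?_⟩
    ext x
    refine ⟨fun h i => h _ (E.equivFin.symm i).2, fun h b hb => ?_⟩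
    simpa using h (E.equivFin ⟨b, hb⟩)
  · refine Set.eq_univ_of_forall fun x => ?_
    obtain ⟨a, ha, hax⟩ := hex x
    refine ⟨_, ⟨a, ha, rfl⟩, fun b hb => ?_⟩
    rw [sub_dotProduct, hax]
    exact sub_nonpos.2 (hle b hb x)
  · rintro _ ⟨a, ha, rfl⟩
    refine ⟨dotProductBilin ℝ ℝ a, fun x hx => ?_⟩
    obtain ⟨b, hb, hbx⟩ := hex x
    have h := hx b hb
    rw [sub_dotProduct, hbx] at h
    exact le_antisymm (sub_nonpos.1 h) (hle a ha x)

/-- Two extreme points of the polar of a finite set with the same active constraints are equal, so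
that there are finitely many of them. -/
theorem finite_extremePoints_polar {n : ℕ} {Y : Set (Fin n → ℝ)} (hY : Y.Finite) :
    (Set.extremePoints ℝ {a : Fin n → ℝ | ∀ y ∈ Y, a ⬝ᵥ y ≤ 1}).Finite := by
  refine Set.Finite.of_finite_image (f := fun a => {y ∈ Y | a ⬝ᵥ y = 1})
    (hY.finite_subsets.subset ?_) ?_
  · rintro _ ⟨a, _, rfl⟩
    exact Set.sep_subset _ _
  · intro a ha b hb hab
    -- A short step from `a` away from `b` stays in the polar: constraints slack at `a` remain so,
    -- and those active at `a` are active at `b`. Thus `a` lies inside a segment ending at `b`, and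
    -- extremality forces equality.
    have hev : ∀ᶠ ε : ℝ in nhdsWithin 0 (Set.Ioi 0), ∀ y ∈ Y, (a - ε • (b - a)) ⬝ᵥ y ≤ 1 := by
      rw [Filter.eventually_all_finite hY]
      intro y hy
      rcases (ha.1 y hy).lt_or_eq with h | h
      · have hc : Continuous fun ε : ℝ => (a - ε • (b - a)) ⬝ᵥ y := by fun_prop
        have := hc.tendsto 0
        simp only [zero_smul, sub_zero] at this
        exact ((this.eventually_lt_const h).filter_mono nhdsWithin_le_nhds).mono fun _ h => h.le
      · have hby : b ⬝ᵥ y = 1 := by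
          exact (hab.subset (show y ∈ {y ∈ Y | a ⬝ᵥ y = 1} from ⟨hy, h⟩)).2
        refine Filter.Eventually.of_forall fun ε => ?_
        rw [sub_dotProduct, smul_dotProduct, sub_dotProduct, h, hby]
        simp
    obtain ⟨ε, hε, hε0⟩ := (hev.and self_mem_nhdsWithin).exists
    have hε0 : 0 < ε := hε0
    refine (ha.2 hb.1 hε ⟨ε / (1 + ε), 1 / (1 + ε), by positivity, by positivity, ?_, ?_⟩).symm
    · field_simp
      ring
    · ext i
      simp only [Pi.add_apply, Pi.smul_apply, Pi.sub_apply, smul_eq_mul]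
      field_simp
      ring

/-- Hahn–Banach, extending `c • x ↦ c * V x` from the line through `x`. -/
theorem Seminorm.exists_dotProduct_eq {n : ℕ} (V : Seminorm ℝ (Fin n → ℝ)) (x : Fin n → ℝ) :
    ∃ a : Fin n → ℝ, a ⬝ᵥ x = V x ∧ ∀ z, a ⬝ᵥ z ≤ V z := by
  rcases eq_or_ne x 0 with rfl | hx
  · exact ⟨0, by simp, fun z => by simp⟩
  obtain ⟨g, hg, hgle⟩ := exists_extension_of_le_sublinear
    (LinearPMap.mkSpanSingleton x (V x) hx) V
    (fun c hc z => by rw [map_smul_eq_mul, Real.norm_of_nonneg hc.le]) (map_add_le_add V) (by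
      rintro ⟨z, hz⟩
      obtain ⟨c, rfl⟩ := Submodule.mem_span_singleton.1 hz
      rw [LinearPMap.mkSpanSingleton'_apply, map_smul_eq_mul, smul_eq_mul]
      exact mul_le_mul_of_nonneg_right (Real.le_norm_self c) (apply_nonneg V x))
  refine ⟨(dotProductEquiv ℝ (Fin n)).symm g, ?_, fun z => ?_⟩
  · have := hg ⟨x, Submodule.mem_span_singleton_self x⟩
    rw [LinearPMap.mkSpanSingleton_apply] at this
    rw [← this]
    exact LinearMap.congr_fun ((dotProductEquiv ℝ (Fin n)).apply_symm_apply g) x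
  · refine le_of_eq_of_le ?_ (hgle z)
    exact LinearMap.congr_fun ((dotProductEquiv ℝ (Fin n)).apply_symm_apply g) z

/-- A linear functional bounded by `1` on the unit ball of a seminorm is bounded by the seminorm. -/
theorem Seminorm.le_of_forall_le_one {n : ℕ} {V : Seminorm ℝ (Fin n → ℝ)} {p : (Fin n → ℝ) → ℝ}
    {c : ℝ} (hp : ∀ (t : ℝ) (x), 0 < t → p (t • x) = t * p x) (h : ∀ x, V x ≤ 1 → p x ≤ c)
    (x : Fin n → ℝ) : p x ≤ c * V x := by
  have key : ∀ t > V x, p x ≤ c * t := by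
    intro t ht
    have ht0 : 0 < t := (apply_nonneg V x).trans_lt ht
    have := h (t⁻¹ • x) (by
      rw [map_smul_eq_mul, Real.norm_of_nonneg (by positivity)]
      rw [inv_mul_le_one₀ ht0]
      exact ht.le)
    rw [hp _ _ (by positivity), inv_mul_le_iff₀ ht0] at this
    linarith
  have hlim : Filter.Tendsto (fun t => c * t) (nhdsWithin (V x) (Set.Ioi (V x)))
      (nhds (c * V x)) :=
    ((continuous_const.mul continuous_id).tendsto _).mono_left nhdsWithin_le_nhds
  exact ge_of_tendsto hlim (Filter.eventually_of_mem self_mem_nhdsWithin key)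

/-- A seminorm whose unit ball is a polytope is a continuous piecewise linear function. -/
theorem isCPWL_of_closedBall_eq_convexHull {n : ℕ} {V : Seminorm ℝ (Fin n → ℝ)}
    {Y : Set (Fin n → ℝ)} (hY : Y.Finite) (hV : V.closedBall 0 1 = convexHull ℝ Y) :
    CPWLJSR.IsCPWL V := by
  set Q : Set (Fin n → ℝ) := {a | ∀ y ∈ Y, a ⬝ᵥ y ≤ 1} with hQ
  have hball : ∀ x, V x ≤ 1 ↔ x ∈ convexHull ℝ Y := by
    intro x
    rw [← hV, Seminorm.mem_closedBall_zero]
  have hQV : ∀ a ∈ Q, ∀ x, a ⬝ᵥ x ≤ V x := by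
    intro a ha x
    rw [← one_mul (V x)]
    refine Seminorm.le_of_forall_le_one (p := fun x => a ⬝ᵥ x)
      (fun t x _ => by simp) (fun x hx => ?_) x
    have hconv : Convex ℝ {x | a ⬝ᵥ x ≤ 1} :=
      convex_halfSpace_le (dotProductBilin ℝ ℝ a).isLinear 1
    exact convexHull_min ha hconv ((hball x).1 hx)
  have hVQ : ∀ a : Fin n → ℝ, (∀ x, a ⬝ᵥ x ≤ V x) → a ∈ Q := fun a ha y hy =>
    (ha y).trans ((hball y).2 (subset_convexHull ℝ Y hy))
  have hcomp : IsCompact Q := by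
    refine (isCompact_univ_pi fun i =>
      isCompact_Icc (a := -V (Pi.single i 1)) (b := V (Pi.single i 1))).of_isClosed_subset ?_ ?_
    · simp only [hQ, Set.ofPred_forall]
      exact isClosed_biInter fun y _ =>
        isClosed_le (continuous_id.dotProduct continuous_const) continuous_const
    · intro a ha i _
      have h1 := hQV a ha (Pi.single i 1)
      have h2 := hQV a ha (-Pi.single i 1)
      rw [map_neg_eq_map, dotProduct_neg] at h2
      rw [dotProduct_single_one] at h1 h2
      exact ⟨by linarith, h1⟩
  refine isCPWL_of_finite_dotProduct (finite_extremePoints_polar hY)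
    (fun a ha => hQV a ha.1) fun x => ?_
  let l : StrongDual ℝ (Fin n → ℝ) := (dotProductBilin ℝ ℝ x).toContinuousLinearMap
  have hl : ∀ a, l a = a ⬝ᵥ x := fun a => dotProduct_comm x a
  obtain ⟨a, hax, ha⟩ := V.exists_dotProduct_eq x
  -- The face of `Q` maximizing `l` is compact and, by Hahn–Banach, nonempty with value `V x`. Its
  -- extreme points are extreme in `Q`, so `V` is a maximum over finitely many functionals.
  have hexp : IsExposed ℝ Q (l.toExposed Q) := ContinuousLinearMap.toExposed.isExposed
  obtain ⟨b, hb⟩ := (hexp.isCompact hcomp).extremePoints_nonempty ⟨a, hVQ a ha, fun y hy => by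
    rw [hl, hl, hax]; exact hQV y hy x⟩
  refine ⟨b, hexp.isExtreme.extremePoints_subset_extremePoints hb, ?_⟩
  refine le_antisymm (hQV b hb.1.1 x) ?_
  have := hb.1.2 a (hVQ a ha)
  rwa [hl, hl, hax] at this

theorem isNorm_of_isBounded_closedBall {n : ℕ} {V : Seminorm ℝ (Fin n → ℝ)}
    (hV : Bornology.IsBounded (V.closedBall 0 1)) : CPWLJSR.IsNorm V := by
  intro x hx
  obtain ⟨C, hC⟩ := hV.exists_norm_le
  by_contra h
  have hpos : 0 < ‖x‖ := norm_pos_iff.2 h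
  have := hC (((C + 1) / ‖x‖) • x) (by
    rw [Seminorm.mem_closedBall_zero, map_smul_eq_mul, hx, mul_zero]
    exact zero_le_one)
  rw [norm_smul, norm_div, norm_norm, div_mul_cancel₀ _ hpos.ne'] at this
  linarith [Real.le_norm_self (C + 1)]

/-- A symmetric finite set whose convex hull is a neighbourhood of `0` defines a CPWL norm. -/
theorem exists_cpwlNorm_of_convexHull_mem_nhds {n N : ℕ} {Y : Set (Fin n → ℝ)} (hY : Y.Finite)
    (hsymm : ∀ y ∈ Y, -y ∈ Y) (h0 : convexHull ℝ Y ∈ nhds 0) (hN : Y.encard ≤ N) :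
    ∃ V ∈ CPWLJSR.cpwlNorms n N, ∀ x, V x ≤ 1 ↔ x ∈ convexHull ℝ Y := by
  have hneg : ∀ x ∈ convexHull ℝ Y, -x ∈ convexHull ℝ Y := by
    intro x hx
    have hY' : -Y = Y := Set.Subset.antisymm (fun y hy => by simpa using hsymm _ hy)
      fun y hy => by simpa using hsymm y hy
    rw [← hY', convexHull_neg]
    simpa using hx
  have hbal : Balanced ℝ (convexHull ℝ Y) :=
    (balanced_iff_neg_mem (convex_convexHull ℝ Y)).2 fun {x} hx => hneg x hx
  let V : Seminorm ℝ (Fin n → ℝ) :=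
    gaugeSeminorm hbal (convex_convexHull ℝ Y) (absorbent_nhds_zero h0)
  have hV : ∀ x, V x ≤ 1 ↔ x ∈ convexHull ℝ Y := by
    intro x
    have := gauge_le_one_iff_mem_closure (x := x) (convex_convexHull ℝ Y) h0
    rwa [(hY.isClosed_convexHull (𝕜 := ℝ)).closure_eq] at this
  have hball : V.closedBall 0 1 = convexHull ℝ Y := by
    ext x
    rw [Seminorm.mem_closedBall_zero, hV]
  refine ⟨V, ⟨isNorm_of_isBounded_closedBall ?_, isCPWL_of_closedBall_eq_convexHull hY hball, ?_⟩,
    hV⟩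
  · rw [hball]
    exact (hY.isCompact_convexHull (𝕜 := ℝ)).isBounded
  · rw [hball]
    exact (Set.encard_le_encard extremePoints_convexHull_subset).trans hN

/-! ### Approximating a symmetric convex body -/

/-- A symmetric convex body is approximated within the factor `τ` by the unit ball of a CPWL norm
with few vertices. -/
theorem exists_cpwlNorm_approx {n : ℕ} (hn : 0 < n) {B : Set (Fin n → ℝ)} (hB : IsCompact B)
    (hconv : Convex ℝ B) (hsymm : ∀ x ∈ B, -x ∈ B) (h0 : B ∈ nhds 0)
    {τ : ℝ} (hτ : 1 < τ) {k : ℕ}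
    (hk : 6 * √(CPWLJSR.barvinokD n k : ℝ) ≤
      (τ - √(τ ^ 2 - 1)) ^ k + (τ + √(τ ^ 2 - 1)) ^ k) :
    ∃ V ∈ CPWLJSR.cpwlNorms n (8 * CPWLJSR.barvinokD n k),
      (∀ x, V x ≤ 1 → x ∈ B) ∧ ∀ x ∈ B, V x ≤ τ := by
  obtain ⟨d, hd, x, hxB, hx⟩ := exists_family_controlling_dotProduct hn hB hτ hk
  have hτ0 : 0 < τ := by linarith
  -- An empty family would bound every functional on `B` by `τ`, which fails since `B` contains some
  -- `t • e` with `t > 0`.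
  have hne : Nonempty (Fin d ⊕ Fin d) := by
    by_contra hcon
    rw [not_nonempty_iff] at hcon
    let e : Fin n → ℝ := Pi.single ⟨0, hn⟩ 1
    have hlim : Filter.Tendsto (fun t : ℝ => t • e) (nhdsWithin 0 (Set.Ioi 0)) (nhds 0) := by
      have h : Continuous fun t : ℝ => t • e := by fun_prop
      simpa using (h.tendsto 0).mono_left nhdsWithin_le_nhds
    obtain ⟨t, htB, ht⟩ := ((hlim.eventually_mem h0).and self_mem_nhdsWithin).exists
    have ht : 0 < t := ht
    have h := hx ((2 * τ / t) • e) (fun i => isEmptyElim i) _ htB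
    have he : e ⟨0, hn⟩ = 1 := Pi.single_eq_same _ _
    rw [smul_dotProduct, dotProduct_smul, dotProduct_single_one, he, smul_eq_mul, smul_eq_mul,
      mul_one, div_mul_cancel₀ _ ht.ne', abs_of_pos (by positivity)] at h
    linarith
  let Y : Set (Fin n → ℝ) := Set.range x ∪ Set.range (-x)
  have hY : Y.Finite := (Set.finite_range _).union (Set.finite_range _)
  have hYB : Y ⊆ B := by
    rintro _ (⟨i, rfl⟩ | ⟨i, rfl⟩)
    exacts [hxB i, hsymm _ (hxB i)]
  have hYsymm : ∀ y ∈ Y, -y ∈ Y := by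
    rintro _ (⟨i, rfl⟩ | ⟨i, rfl⟩)
    exacts [Or.inr ⟨i, rfl⟩, Or.inl ⟨i, by simp⟩]
  have hcard : Y.encard ≤ (8 * CPWLJSR.barvinokD n k : ℕ) := by
    have hr : ∀ z : Fin d ⊕ Fin d → Fin n → ℝ, (Set.range z).encard ≤ (2 * d : ℕ) := by
      intro z
      rw [← Set.image_univ]
      refine (Set.encard_image_le _ _).trans ?_
      rw [Set.encard_univ, ENat.card_eq_coe_fintype_card]
      simp [two_mul]
    refine (Set.encard_union_le _ _).trans ((add_le_add (hr _) (hr _)).trans ?_)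
    exact_mod_cast (by lia : 2 * d + 2 * d ≤ 8 * CPWLJSR.barvinokD n k)
  have hsub : ∀ y ∈ B, τ⁻¹ • y ∈ convexHull ℝ Y := by
    intro y hy
    -- Separate `τ⁻¹ • y` from the hull by `f` at level `u`. Symmetry of `Y` gives `|f (x i)| < u`,
    -- so `u⁻¹ • f` is at most `τ` at `y`, whereas separation says `f y > τ u`.
    by_contra hcon
    obtain ⟨f, u, hfu, huf⟩ := geometric_hahn_banach_closed_point (convex_convexHull ℝ Y)
      (hY.isClosed_convexHull (𝕜 := ℝ)) hcon
    let a := (dotProductEquiv ℝ (Fin n)).symm (f : (Fin n → ℝ) →ₗ[ℝ] ℝ)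
    have ha : ∀ z, a ⬝ᵥ z = f z := fun z =>
      LinearMap.congr_fun ((dotProductEquiv ℝ (Fin n)).apply_symm_apply _) z
    have hlt : ∀ i, |f (x i)| < u := by
      intro i
      refine abs_lt.2 ⟨?_, hfu _ (subset_convexHull ℝ Y (Or.inl ⟨i, rfl⟩))⟩
      have := hfu _ (subset_convexHull ℝ Y (Or.inr ⟨i, rfl⟩))
      rw [Pi.neg_apply, map_neg] at this
      linarith
    obtain ⟨i⟩ := hne
    have hu : 0 < u := (abs_nonneg _).trans_lt (hlt i)
    rw [map_smul, smul_eq_mul, lt_inv_mul_iff₀ hτ0] at huf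
    have := hx (u⁻¹ • a) (fun i => by
      rw [smul_dotProduct, ha, smul_eq_mul, abs_mul, abs_of_pos (inv_pos.2 hu),
        inv_mul_le_one₀ hu]
      exact (hlt i).le) y hy
    rw [smul_dotProduct, ha, smul_eq_mul, abs_mul, abs_of_pos (inv_pos.2 hu),
      inv_mul_le_iff₀ hu] at this
    linarith [le_abs_self (f y)]
  have hP0 : convexHull ℝ Y ∈ nhds 0 := by
    refine Filter.mem_of_superset ((set_smul_mem_nhds_zero_iff (inv_ne_zero hτ0.ne')).2 h0) ?_
    rintro _ ⟨y, hy, rfl⟩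
    exact hsub y hy
  obtain ⟨V, hV, hV1⟩ := exists_cpwlNorm_of_convexHull_mem_nhds hY hYsymm hP0 hcard
  refine ⟨V, hV, fun y hy => convexHull_min hYB hconv ((hV1 y).1 hy), fun y hy => ?_⟩
  have := (hV1 _).2 (hsub y hy)
  rwa [map_smul_eq_mul, Real.norm_of_nonneg (by positivity), inv_mul_le_one₀ hτ0] at this

/-! ### Matrix products and growth rates in a norm -/

namespace CPWLJSR

variable {n : ℕ} {S : Set (Matrix (Fin n) (Fin n) ℝ)}

theorem products_finite (hS : S.Finite) (k : ℕ) : (products S k).Finite := by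
  refine ((Set.Finite.pi' fun _ : Fin k => hS).image fun A => (List.ofFn A).prod).subset ?_
  rintro _ ⟨A, hA, rfl⟩
  exact ⟨A, hA, rfl⟩

theorem products_nonempty (hS : S.Nonempty) (k : ℕ) : (products S k).Nonempty :=
  let ⟨A, hA⟩ := hS
  ⟨_, fun _ => A, fun _ => hA, rfl⟩

theorem one_mem_products_zero : (1 : Matrix (Fin n) (Fin n) ℝ) ∈ products S 0 :=
  ⟨Fin.elim0, fun i => i.elim0, by simp⟩

theorem mul_mem_products_succ {k : ℕ} {M A : Matrix (Fin n) (Fin n) ℝ} (hM : M ∈ products S k)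
    (hA : A ∈ S) : M * A ∈ products S (k + 1) := by
  obtain ⟨f, hf, rfl⟩ := hM
  refine ⟨Fin.snoc (α := fun _ => Matrix (Fin n) (Fin n) ℝ) f A, fun i => ?_, ?_⟩
  · refine Fin.lastCases ?_ (fun i => ?_) i
    · simpa using hA
    · simpa using hf i
  · rw [List.ofFn_succ']
    simp

theorem seminorm_mulVec_le_of_mem_products {V : Seminorm ℝ (Fin n → ℝ)} {c : ℝ} (hc : 0 ≤ c)
    (hV : ∀ A ∈ S, ∀ x, V (A.mulVec x) ≤ c * V x) (k : ℕ) :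
    ∀ M ∈ products S k, ∀ x, V (M.mulVec x) ≤ c ^ k * V x := by
  induction k with
  | zero =>
    rintro _ ⟨f, hf, rfl⟩ x
    simp
  | succ k ih =>
    rintro _ ⟨f, hf, rfl⟩ x
    rw [List.ofFn_succ, List.prod_cons, ← Matrix.mulVec_mulVec, pow_succ', mul_assoc]
    refine (hV _ (hf 0) _).trans (mul_le_mul_of_nonneg_left ?_ hc)
    exact ih _ ⟨_, fun i => hf i.succ, rfl⟩ x

/-- A continuous norm is equivalent to the Euclidean norm. -/
theorem IsNorm.exists_equiv_euclidean {V : Seminorm ℝ (Fin n → ℝ)} (hV : IsNorm V)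
    (hcont : Continuous V) :
    ∃ C > 0, ∀ x, V x ≤ C * ‖WithLp.toLp 2 x‖ ∧ ‖WithLp.toLp 2 x‖ ≤ C * V x := by
  let W : Seminorm ℝ (EuclideanSpace ℝ (Fin n)) :=
    V.comp (WithLp.linearEquiv 2 ℝ (Fin n → ℝ)).toLinearMap
  have hW : ∀ z, W z = V (WithLp.ofLp z) := fun z => rfl
  have hWcont : Continuous W := hcont.comp (PiLp.continuous_ofLp 2 _)
  obtain ⟨K, hK, hVK⟩ := W.bound_of_continuous_normedSpace hWcont
  have hpos : ∀ z ∈ Metric.sphere (0 : EuclideanSpace ℝ (Fin n)) 1, 0 < W z := by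
    intro z hz
    refine (apply_nonneg W z).lt_of_ne fun h => ?_
    have : z = 0 := by
      ext i
      exact congrFun (hV _ h.symm) i
    simp [this] at hz
  obtain ⟨b, hb⟩ := (isCompact_sphere (0 : EuclideanSpace ℝ (Fin n)) 1).bddAbove_image
    -- Bounding `1 / W` on the compact sphere gives the reverse comparison by scaling.
    (hWcont.continuousOn.inv₀ fun z hz => (hpos z hz).ne')
  refine ⟨max K b, lt_max_of_lt_left hK, fun x => ⟨?_, ?_⟩⟩
  · refine (hVK (WithLp.toLp 2 x)).trans ?_
    gcongr
    exact le_max_left _ _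
  · rcases eq_or_ne x 0 with rfl | hx
    · simp
    have hx0 : 0 < ‖WithLp.toLp 2 x‖ := by simpa using hx
    have hz : ‖WithLp.toLp 2 x‖⁻¹ • WithLp.toLp 2 x ∈
        Metric.sphere (0 : EuclideanSpace ℝ (Fin n)) 1 := by
      rw [mem_sphere_zero_iff_norm, norm_smul, norm_inv, norm_norm, inv_mul_cancel₀ hx0.ne']
    have h1 := hb ⟨_, hz, rfl⟩
    have h2 := hpos _ hz
    have h3 := (inv_le_iff_one_le_mul₀ h2).1 h1
    rw [map_smul_eq_mul, norm_inv, norm_norm, hW] at h3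
    have h4 : ‖WithLp.toLp 2 x‖ ≤ b * V x := by
      calc ‖WithLp.toLp 2 x‖ ≤ (b * (‖WithLp.toLp 2 x‖⁻¹ * V x)) * ‖WithLp.toLp 2 x‖ := by
            exact le_mul_of_one_le_left hx0.le h3
        _ = b * V x := by field_simp
    refine h4.trans ?_
    gcongr
    exact le_max_right _ _

theorem norm_toLp_mulVec_le (A : Matrix (Fin n) (Fin n) ℝ) (x : Fin n → ℝ) :
    ‖WithLp.toLp 2 (A.mulVec x)‖ ≤
      ‖Matrix.toEuclideanCLM (n := Fin n) (𝕜 := ℝ) A‖ * ‖WithLp.toLp 2 x‖ := by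
  rw [← Matrix.toEuclideanCLM_toLp]
  exact ContinuousLinearMap.le_opNorm _ _

theorem inducedNorm_nonneg (V : Seminorm ℝ (Fin n → ℝ)) (A : Matrix (Fin n) (Fin n) ℝ) :
    0 ≤ inducedNorm V A :=
  Real.sInf_nonneg fun _ hc => hc.1

theorem inducedNorm_le {V : Seminorm ℝ (Fin n → ℝ)} {A : Matrix (Fin n) (Fin n) ℝ} {c : ℝ}
    (hc : 0 ≤ c) (h : ∀ x, V (A.mulVec x) ≤ c * V x) : inducedNorm V A ≤ c :=
  csInf_le ⟨0, fun _ hc => hc.1⟩ ⟨hc, h⟩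

theorem IsNorm.apply_mulVec_le_inducedNorm {V : Seminorm ℝ (Fin n → ℝ)} (hV : IsNorm V)
    (hcont : Continuous V) (A : Matrix (Fin n) (Fin n) ℝ) (x : Fin n → ℝ) :
    V (A.mulVec x) ≤ inducedNorm V A * V x := by
  rcases (apply_nonneg V x).eq_or_lt with h | h
  · simp [hV x h.symm]
  obtain ⟨C, hC, hVC⟩ := hV.exists_equiv_euclidean hcont
  rw [← div_le_iff₀ h]
  -- Equivalence with the Euclidean norm supplies an admissible constant, so the infimum is over a
  -- nonempty set.
  refine le_csInf ⟨C * (‖Matrix.toEuclideanCLM (n := Fin n) (𝕜 := ℝ) A‖ * C), by positivity,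
    fun z => ?_⟩ fun c hc => (div_le_iff₀ h).2 (hc.2 x)
  calc V (A.mulVec z) ≤ C * ‖WithLp.toLp 2 (A.mulVec z)‖ := (hVC _).1
    _ ≤ C * (‖Matrix.toEuclideanCLM (n := Fin n) (𝕜 := ℝ) A‖ * ‖WithLp.toLp 2 z‖) := by
        gcongr
        exact norm_toLp_mulVec_le A z
    _ ≤ C * (‖Matrix.toEuclideanCLM (n := Fin n) (𝕜 := ℝ) A‖ * (C * V z)) := by
        gcongr
        exact (hVC z).2
    _ = C * (‖Matrix.toEuclideanCLM (n := Fin n) (𝕜 := ℝ) A‖ * C) * V z := by ring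

/-- The largest value of `‖M‖ ^ (1 / k)` over the products `M` of length `k`. -/
noncomputable def maxRootNorm (S : Set (Matrix (Fin n) (Fin n) ℝ)) (k : ℕ) : ℝ :=
  sSup ((fun A : Matrix (Fin n) (Fin n) ℝ =>
    ‖Matrix.toEuclideanCLM (n := Fin n) (𝕜 := ℝ) A‖ ^ (1 / (k : ℝ))) '' products S k)

theorem maxRootNorm_nonneg (k : ℕ) : 0 ≤ maxRootNorm S k := by
  refine Real.sSup_nonneg ?_
  rintro _ ⟨A, _, rfl⟩
  positivity

theorem norm_le_pow_maxRootNorm (hS : S.Finite) {k : ℕ} (hk : k ≠ 0)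
    {M : Matrix (Fin n) (Fin n) ℝ} (hM : M ∈ products S k) :
    ‖Matrix.toEuclideanCLM (n := Fin n) (𝕜 := ℝ) M‖ ≤ maxRootNorm S k ^ k := by
  rw [← Real.rpow_inv_natCast_pow (norm_nonneg (Matrix.toEuclideanCLM (n := Fin n) (𝕜 := ℝ) M)) hk,
    ← one_div]
  gcongr
  exact le_csSup ((products_finite hS k).image _).bddAbove ⟨M, hM, rfl⟩

/-- The prefactor disappears because `C ^ (1 / k) → 1`; the strict gap `c < c'` absorbs the error.
-/
theorem eventually_maxRootNorm_le (hne : S.Nonempty) {C c c' : ℝ} (hC : 0 < C) (hc : 0 ≤ c)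
    (h : ∀ k, ∀ M ∈ products S k,
      ‖Matrix.toEuclideanCLM (n := Fin n) (𝕜 := ℝ) M‖ ≤ C * c ^ k) (hcc : c < c') :
    ∀ᶠ k in Filter.atTop, maxRootNorm S k ≤ c' := by
  have hlim : Filter.Tendsto (fun k : ℕ => C ^ (1 / (k : ℝ)) * c) Filter.atTop (nhds c) := by
    have h0 : Filter.Tendsto (fun k : ℕ => 1 / (k : ℝ)) Filter.atTop (nhds 0) :=
      tendsto_one_div_atTop_nhds_zero_nat
    have := ((Real.continuousAt_const_rpow hC.ne').tendsto.comp h0).mul_const c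
    simpa using this
  filter_upwards [hlim.eventually_lt_const hcc, Filter.eventually_ne_atTop 0] with k hk hk0
  refine csSup_le ((products_nonempty hne k).image _) ?_
  rintro _ ⟨M, hM, rfl⟩
  refine le_trans ?_ hk.le
  calc ‖Matrix.toEuclideanCLM (n := Fin n) (𝕜 := ℝ) M‖ ^ (1 / (k : ℝ))
      ≤ (C * c ^ k) ^ (1 / (k : ℝ)) := by
        gcongr
        exact h k M hM
    _ = C ^ (1 / (k : ℝ)) * c := by
        rw [Real.mul_rpow hC.le (by positivity)]
        congr 1
        rw [one_div, Real.pow_rpow_inv_natCast hc hk0]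

/-- Submultiplicativity bounds products of length `k` by `L ^ k`. Boundedness is what makes the real
`limsup` meaningful. -/
theorem isBoundedUnder_maxRootNorm (hS : S.Finite) (hne : S.Nonempty) :
    Filter.IsBoundedUnder (· ≤ ·) Filter.atTop (maxRootNorm S) := by
  obtain ⟨L, hL⟩ := (hS.image fun A : Matrix (Fin n) (Fin n) ℝ =>
    ‖Matrix.toEuclideanCLM (n := Fin n) (𝕜 := ℝ) A‖).bddAbove
  have hL' : ∀ A ∈ S, ‖Matrix.toEuclideanCLM (n := Fin n) (𝕜 := ℝ) A‖ ≤ L :=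
    fun A hA => hL ⟨A, hA, rfl⟩
  have hL0 : 0 ≤ L := let ⟨A, hA⟩ := hne; (norm_nonneg _).trans (hL' A hA)
  refine ⟨L + 1, eventually_maxRootNorm_le hne one_pos hL0 (fun k M hM => ?_) (lt_add_one L)⟩
  rw [one_mul]
  refine ContinuousLinearMap.opNorm_le_bound _ (by positivity) fun z => ?_
  let V : Seminorm ℝ (Fin n → ℝ) := (normSeminorm ℝ (EuclideanSpace ℝ (Fin n))).comp
    (WithLp.linearEquiv 2 ℝ (Fin n → ℝ)).symm.toLinearMap
  refine seminorm_mulVec_le_of_mem_products (V := V) hL0 (fun A hA x => ?_) k M hM (WithLp.ofLp z)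
  exact (norm_toLp_mulVec_le A x).trans (mul_le_mul_of_nonneg_right (hL' A hA) (norm_nonneg _))

theorem jointSpectralRadius_nonneg (hS : S.Finite) (hne : S.Nonempty) :
    0 ≤ jointSpectralRadius S :=
  Filter.le_limsup_of_frequently_le (Filter.Frequently.of_forall maxRootNorm_nonneg)
    (isBoundedUnder_maxRootNorm hS hne)

/-- The joint spectral radius is at most the rate of expansion in any norm. -/
theorem jointSpectralRadius_le (hne : S.Nonempty) {V : Seminorm ℝ (Fin n → ℝ)} (hV : IsNorm V)
    (hcont : Continuous V) {c : ℝ} (hc : 0 ≤ c)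
    (h : ∀ A ∈ S, ∀ x, V (A.mulVec x) ≤ c * V x) : jointSpectralRadius S ≤ c := by
  obtain ⟨C, hC, hVC⟩ := hV.exists_equiv_euclidean hcont
  refine le_of_forall_gt_imp_ge_of_dense fun c' hc' => ?_
  refine Filter.limsup_le_of_le
    (Filter.isCoboundedUnder_le_of_le Filter.atTop (x := 0) maxRootNorm_nonneg)
    (eventually_maxRootNorm_le hne (mul_pos hC hC) hc (fun k M hM => ?_) hc')
  refine ContinuousLinearMap.opNorm_le_bound _ (by positivity) fun z => ?_
  calc ‖WithLp.toLp 2 (M.mulVec (WithLp.ofLp z))‖ ≤ C * V (M.mulVec (WithLp.ofLp z)) := (hVC _).2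
    _ ≤ C * (c ^ k * V (WithLp.ofLp z)) := by
        gcongr
        exact seminorm_mulVec_le_of_mem_products hc h k M hM _
    _ ≤ C * (c ^ k * (C * ‖z‖)) := by
        gcongr
        exact (hVC _).1
    _ = C * C * c ^ k * ‖z‖ := by ring

/-! ### The orbit body -/

/-- The points whose orbit under products of length `j` is bounded by `r ^ j`. -/
def orbitBody (S : Set (Matrix (Fin n) (Fin n) ℝ)) (r : ℝ) : Set (Fin n → ℝ) :=
  {x | ∀ j, ∀ M ∈ products S j, ‖WithLp.toLp 2 (M.mulVec x)‖ ≤ r ^ j}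

theorem continuous_norm_toLp_mulVec (M : Matrix (Fin n) (Fin n) ℝ) :
    Continuous fun x => ‖WithLp.toLp 2 (M.mulVec x)‖ :=
  ((PiLp.continuous_toLp 2 _).comp (continuous_const.matrix_mulVec continuous_id)).norm

theorem isCompact_orbitBody (r : ℝ) : IsCompact (orbitBody S r) := by
  refine ((isCompact_closedBall (0 : EuclideanSpace ℝ (Fin n)) 1).image
    (PiLp.continuous_ofLp 2 _)).of_isClosed_subset ?_ ?_
  · simp only [orbitBody, Set.ofPred_forall]
    exact isClosed_iInter fun j => isClosed_biInter fun M _ =>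
      isClosed_le (continuous_norm_toLp_mulVec M) continuous_const
  · intro x hx
    refine ⟨WithLp.toLp 2 x, ?_, rfl⟩
    -- The empty product, `j = 0`, confines the body to the Euclidean unit ball.
    simpa using hx 0 1 one_mem_products_zero

theorem convex_orbitBody (r : ℝ) : Convex ℝ (orbitBody S r) := by
  intro x hx y hy a b ha hb hab j M hM
  rw [Matrix.mulVec_add, Matrix.mulVec_smul, Matrix.mulVec_smul, WithLp.toLp_add, WithLp.toLp_smul,
    WithLp.toLp_smul]
  calc _ ≤ a * ‖WithLp.toLp 2 (M.mulVec x)‖ + b * ‖WithLp.toLp 2 (M.mulVec y)‖ := by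
        refine (norm_add_le _ _).trans_eq ?_
        rw [norm_smul, norm_smul, Real.norm_of_nonneg ha, Real.norm_of_nonneg hb]
    _ ≤ a * r ^ j + b * r ^ j := by
        gcongr
        exacts [hx j M hM, hy j M hM]
    _ = r ^ j := by rw [← add_mul, hab, one_mul]

theorem neg_mem_orbitBody {r : ℝ} {x : Fin n → ℝ} (hx : x ∈ orbitBody S r) :
    -x ∈ orbitBody S r := by
  intro j M hM
  rw [Matrix.mulVec_neg, WithLp.toLp_neg, norm_neg]
  exact hx j M hM

/-- For large `j` all products have norm at most `r ^ j`, so the Euclidean unit ball meets those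
constraints; finitely many continuous constraints remain. -/
theorem orbitBody_mem_nhds_zero (hS : S.Finite) (hne : S.Nonempty) {r : ℝ}
    (hr : jointSpectralRadius S < r) : orbitBody S r ∈ nhds 0 := by
  have hr0 : 0 < r := (jointSpectralRadius_nonneg hS hne).trans_lt hr
  obtain ⟨K, hK⟩ := Filter.eventually_atTop.1 ((Filter.eventually_lt_of_limsup_lt hr
    (isBoundedUnder_maxRootNorm hS hne)).and (Filter.eventually_ne_atTop 0))
  have hsmall : ∀ (M : Matrix (Fin n) (Fin n) ℝ) (c : ℝ), 0 < c →
      ∀ᶠ x in nhds 0, ‖WithLp.toLp 2 (M.mulVec x)‖ ≤ c := by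
    intro M c hc
    have := (continuous_norm_toLp_mulVec M).tendsto 0
    simp only [Matrix.mulVec_zero, WithLp.toLp_zero, norm_zero] at this
    exact (this.eventually_lt_const hc).mono fun _ h => h.le
  have h1 : ∀ᶠ x in nhds (0 : Fin n → ℝ), ∀ j ∈ Set.Iio K, ∀ M ∈ products S j,
      ‖WithLp.toLp 2 (M.mulVec x)‖ ≤ r ^ j := by
    rw [Filter.eventually_all_finite (Set.finite_Iio K)]
    intro j _
    rw [Filter.eventually_all_finite (products_finite hS j)]
    exact fun M _ => hsmall M _ (pow_pos hr0 j)
  filter_upwards [h1, hsmall 1 1 one_pos] with x hx hx1 j M hM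
  rcases lt_or_ge j K with hj | hj
  · exact hx j hj M hM
  · obtain ⟨hj1, hj0⟩ := hK j hj
    rw [Matrix.one_mulVec] at hx1
    calc ‖WithLp.toLp 2 (M.mulVec x)‖
        ≤ ‖Matrix.toEuclideanCLM (n := Fin n) (𝕜 := ℝ) M‖ * ‖WithLp.toLp 2 x‖ :=
          norm_toLp_mulVec_le M x
      _ ≤ r ^ j * 1 := by
          gcongr
          exact (norm_le_pow_maxRootNorm hS hj0 hM).trans
            (pow_le_pow_left₀ (maxRootNorm_nonneg j) hj1.le j)
      _ = r ^ j := mul_one _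

/-- If `M` has length `j`, then `M * A` has length `j + 1`, and `r⁻¹` cancels the extra factor `r`.
-/
theorem inv_smul_mulVec_mem_orbitBody {r : ℝ} (hr : 0 < r) {A : Matrix (Fin n) (Fin n) ℝ}
    (hA : A ∈ S) {x : Fin n → ℝ} (hx : x ∈ orbitBody S r) :
    r⁻¹ • A.mulVec x ∈ orbitBody S r := by
  intro j M hM
  rw [Matrix.mulVec_smul, WithLp.toLp_smul, norm_smul, norm_inv, Real.norm_of_nonneg hr.le,
    Matrix.mulVec_mulVec, inv_mul_le_iff₀ hr, ← pow_succ']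
  exact hx (j + 1) _ (mul_mem_products_succ hM hA)

/-! ### Comparing the two radii -/

theorem cpwlRadius_le (hne : S.Nonempty) {N : ℕ} {V : Seminorm ℝ (Fin n → ℝ)}
    (hV : V ∈ cpwlNorms n N) {c : ℝ} (hc : 0 ≤ c)
    (h : ∀ A ∈ S, ∀ x, V (A.mulVec x) ≤ c * V x) : cpwlRadius N S ≤ c := by
  have hbdd : BddBelow ((fun V : Seminorm ℝ (Fin n → ℝ) => sSup (inducedNorm V '' S)) ''
      cpwlNorms n N) := by
    refine ⟨0, ?_⟩
    rintro _ ⟨W, _, rfl⟩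
    refine Real.sSup_nonneg ?_
    rintro _ ⟨A, _, rfl⟩
    exact inducedNorm_nonneg W A
  refine (csInf_le hbdd ⟨V, hV, rfl⟩).trans (csSup_le (hne.image _) ?_)
  rintro _ ⟨A, hA, rfl⟩
  exact inducedNorm_le hc (h A hA)

theorem jointSpectralRadius_le_cpwlRadius (hS : S.Finite) (hne : S.Nonempty) {N : ℕ}
    (hN : (cpwlNorms n N).Nonempty) : jointSpectralRadius S ≤ cpwlRadius N S := by
  -- Nonemptiness matters: the real `sInf` of the empty set is `0`.
  refine le_csInf (hN.image _) ?_
  rintro _ ⟨V, ⟨hV, hpl, _⟩, rfl⟩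
  have hle : ∀ A ∈ S, inducedNorm V A ≤ sSup (inducedNorm V '' S) := fun A hA =>
    le_csSup (hS.image _).bddAbove ⟨A, hA, rfl⟩
  refine jointSpectralRadius_le hne hV hpl.1 ?_ fun A hA x => ?_
  · obtain ⟨A, hA⟩ := hne
    exact (inducedNorm_nonneg V A).trans (hle A hA)
  · exact (hV.apply_mulVec_le_inducedNorm hpl.1 A x).trans
      (mul_le_mul_of_nonneg_right (hle A hA) (apply_nonneg V x))

end CPWLJSR

theorem mainTheorem1 {n : ℕ} (hn : 0 < n)
    (S : Set (Matrix (Fin n) (Fin n) ℝ)) (hfin : S.Finite) (hne : S.Nonempty)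
    (τ : ℝ) (hτ : 1 < τ) (k : ℕ)
    (hk : 6 * √(CPWLJSR.barvinokD n k : ℝ) ≤
      (τ - √(τ ^ 2 - 1)) ^ k + (τ + √(τ ^ 2 - 1)) ^ k) :
    (CPWLJSR.cpwlNorms n (8 * CPWLJSR.barvinokD n k)).Nonempty ∧
      1 / τ * CPWLJSR.cpwlRadius (8 * CPWLJSR.barvinokD n k) S ≤
        CPWLJSR.jointSpectralRadius S ∧
      CPWLJSR.jointSpectralRadius S ≤
        CPWLJSR.cpwlRadius (8 * CPWLJSR.barvinokD n k) S := by
  have hτ0 : 0 < τ := by linarith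
  have happrox : ∀ r > CPWLJSR.jointSpectralRadius S,
      ∃ V ∈ CPWLJSR.cpwlNorms n (8 * CPWLJSR.barvinokD n k),
        (∀ x, V x ≤ 1 → x ∈ CPWLJSR.orbitBody S r) ∧ ∀ x ∈ CPWLJSR.orbitBody S r, V x ≤ τ :=
    fun r hr => exists_cpwlNorm_approx hn (CPWLJSR.isCompact_orbitBody r)
      (CPWLJSR.convex_orbitBody r) (fun _ => CPWLJSR.neg_mem_orbitBody)
      (CPWLJSR.orbitBody_mem_nhds_zero hfin hne hr) hτ hk
  have hN : (CPWLJSR.cpwlNorms n (8 * CPWLJSR.barvinokD n k)).Nonempty :=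
    let ⟨V, hV, _⟩ := happrox _ (lt_add_one _)
    ⟨V, hV⟩
  refine ⟨hN, ?_, CPWLJSR.jointSpectralRadius_le_cpwlRadius hfin hne hN⟩
  refine le_of_forall_gt_imp_ge_of_dense fun r hr => ?_
  have hr0 : 0 < r := (CPWLJSR.jointSpectralRadius_nonneg hfin hne).trans_lt hr
  obtain ⟨V, hV, hVB, hBV⟩ := happrox r hr
  rw [one_div, inv_mul_le_iff₀ hτ0]
  -- The rate is `τ * r`: if `V x ≤ 1`, then `x` and hence `r⁻¹ • A x` lie in the orbit body, where
  -- `V ≤ τ`.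
  refine CPWLJSR.cpwlRadius_le hne hV (by positivity) fun A hA => ?_
  refine Seminorm.le_of_forall_le_one (p := fun x => V (A.mulVec x)) (fun t x ht => ?_)
    fun x hx => ?_
  · rw [Matrix.mulVec_smul, map_smul_eq_mul, Real.norm_of_nonneg ht.le]
  · have := hBV _ (CPWLJSR.inv_smul_mulVec_mem_orbitBody hr0 hA (hVB x hx))
    rwa [map_smul_eq_mul, Real.norm_of_nonneg (by positivity), inv_mul_le_iff₀ hr0,
      mul_comm] at this
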